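/- Let $\mathbb F_\ell$ be a finite field and let $X$ be a smooth algebraic variety over $\mathbb F_\ell$ (a reduced scheme of finite type, smooth over $\mathbb F_\ell$). A *rectification* of $X$ is a finite open cover $X=\bigcup_{\alpha\in I}U_\alpha$ together with closed embeddings over $\mathbb F_\ell$, $i_\alpha:U_\alpha\to\mathbb A^{M_\alpha}$. Given a rectification of $X$, an integer $k\ge 1$, an integer $m\in\mathbb Z$ and a point $x\in X(\mathbb F_{\ell^k}((t)))$, define the following subsets of $X(\mathbb F_{\ell^k}((t)))$: $$B_m^{X,k}:=\bigcup_{\alpha} i_\alpha^{-1}\bigl((t^{-m}\mathbb F_{\ell^k}[[t]])^{M_\alpha}\bigr),\qquad B_m^{X,k}(x):=\bigcup_{\alpha:\ x\in U_\alpha(\mathbb F_{\ell^k}((t)))} i_\alpha^{-1}\bigl(i_\alpha(x)+(t^{-m}\mathbb F_{\ell^k}[[t]])^{M_\alpha}\bigr),$$ and, for a closed subvariety $Z\subset X$, $$B_m^{X,k}(Z):=\bigcup_{z\in Z(\mathbb F_{\ell^k}((t)))}B_m^{X,k}(z).$$ **Proposition.** Let $X$ be a smooth algebraic variety over $\mathbb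 F_\ell$ with a rectification, let $U\subset X$ be an open subset and let $Z:=X\setminus U$. Fix any rectification of $U$ (it need not be related to that of $X$), and let $B_m^{U,k}\subset U(\mathbb F_{\ell^k}((t)))\subset X(\mathbb F_{\ell^k}((t)))$ be the balls it defines. Then for every integer $m\ge 0$ there is an integer $m'>m$ such that for every integer $k\ge 1$ $$B_m^{X,k}\subset B_{m'}^{U,k}\cup B_{-m}^{X,k}(Z).$$ -/

import Mathlib

open CategoryTheory AlgebraicGeometry TopologicalSpace
open scoped LaurentSeries PowerSeries

universe u

noncomputable section

/-- A smooth algebraic variety over a field `𝔽`: a reduced scheme, of finite type and smooth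
over `Spec 𝔽`. -/
class IsSmoothVariety {𝔽 : Type u} [Field 𝔽] {X : Scheme.{u}}
    (f : X ⟶ Spec (CommRingCat.of 𝔽)) : Prop where
  isReduced : IsReduced X
  locallyOfFiniteType : LocallyOfFiniteType f
  quasiCompact : QuasiCompact f
  smooth : Smooth f

/-- Affine space `𝔸^M` over `𝔽`. -/
abbrev AffSpace (𝔽 : Type u) [Field 𝔽] (M : ℕ) : Scheme.{u} :=
  AffineSpace (ULift.{u} (Fin M)) (Spec (CommRingCat.of 𝔽))

/-- The structure morphism of affine space. -/
abbrev AffSpace.str (𝔽 : Type u) [Field 𝔽] (M : ℕ) :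
    AffSpace 𝔽 M ⟶ Spec (CommRingCat.of 𝔽) :=
  AffSpace 𝔽 M ↘ Spec (CommRingCat.of 𝔽)

/-- A rectification of the `𝔽`-scheme `f : X ⟶ Spec 𝔽`: a finite open cover `X = ⋃ U α` together
with closed embeddings, over `𝔽`, of each `U α` into an affine space over `𝔽`. -/
structure Rectification {𝔽 : Type u} [Field 𝔽] {X : Scheme.{u}}
    (f : X ⟶ Spec (CommRingCat.of 𝔽)) where
  I : Type
  finite : Finite I
  chart : I → X.Opens
  cover : ⨆ α, chart α = ⊤
  dim : I → ℕ
  emb : ∀ α, (chart α).toScheme ⟶ AffSpace 𝔽 (dim α)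
  emb_over : ∀ α, emb α ≫ AffSpace.str 𝔽 (dim α) = (chart α).ι ≫ f
  emb_closed : ∀ α, IsClosedImmersion (emb α)

/-- `X(F)`: the set of `F`-points of an `𝔽`-scheme `f : X ⟶ Spec 𝔽`, for an `𝔽`-algebra `F`. -/
def Points {𝔽 : Type u} [Field 𝔽] {X : Scheme.{u}} (f : X ⟶ Spec (CommRingCat.of 𝔽))
    (F : Type u) [CommRing F] [Algebra 𝔽 F] : Type u :=
  {x : Spec (CommRingCat.of F) ⟶ X // x ≫ f = Spec.map (CommRingCat.ofHom (algebraMap 𝔽 F))}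

namespace Points

variable {𝔽 : Type u} [Field 𝔽] {X Y : Scheme.{u}} {f : X ⟶ Spec (CommRingCat.of 𝔽)}
  {F : Type u} [CommRing F] [Algebra 𝔽 F]

/-- The map `X(F) → Y(F)` induced by a morphism `X ⟶ Y` over `𝔽`. -/
def map (g : X ⟶ Y) {f' : Y ⟶ Spec (CommRingCat.of 𝔽)} (h : g ≫ f' = f) (x : Points f F) :
    Points f' F :=
  ⟨x.1 ≫ g, by rw [Category.assoc, h, x.2]⟩

/-- The inclusion `U(F) → X(F)` for an open subscheme `U` of `X`. -/
def incl (U : X.Opens) (x : Points (U.ι ≫ f) F) : Points f F := x.map U.ι rfl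

/-- The coordinates of an `F`-point of affine space. -/
def coord {M : ℕ} (x : Points (AffSpace.str 𝔽 M) F) (j : Fin M) : F :=
  (Scheme.ΓSpecIso (CommRingCat.of F)).hom
    (x.1.appTop (AffineSpace.coord (Spec (CommRingCat.of 𝔽)) (ULift.up j)))

/-- The `F`-points of `X` that lie in a subset `Z` of `X`. For a field `F` and a closed `Z`, these
are the `F`-points of `Z` with its reduced scheme structure, see `Points.mem_in_iff`. -/
def In (f : X ⟶ Spec (CommRingCat.of 𝔽)) (F : Type u) [CommRing F] [Algebra 𝔽 F] (Z : Set X) :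
    Set (Points f F) :=
  {x | ∀ p, x.1 p ∈ Z}

theorem mem_in_iff {F : Type u} [Field F] [Algebra 𝔽 F] (Z : Closeds X) (x : Points f F) :
    x ∈ In f F (Z : Set X) ↔
      ∃ z : Points ((Scheme.IdealSheafData.vanishingIdeal Z).subschemeι ≫ f) F,
        z.map (Scheme.IdealSheafData.vanishingIdeal Z).subschemeι rfl = x := by
  constructor
  · intro h
    have hq : QuasiCompact x.1 := inferInstance
    have h1 : Z ≥ x.1.ker.support := by
      rw [ge_iff_le, ← SetLike.coe_subset_coe, Scheme.Hom.support_ker]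
      refine closure_minimal ?_ Z.isClosed
      rintro _ ⟨p, rfl⟩
      exact h p
    have h2 : (Scheme.IdealSheafData.vanishingIdeal Z) ≤ x.1.ker := by
      refine (Scheme.IdealSheafData.vanishingIdeal_antimono h1).trans ?_
      rw [Scheme.IdealSheafData.vanishingIdeal_support]
      intro V a ha
      rw [Scheme.Hom.ker_apply]
      rw [Scheme.IdealSheafData.radical_ideal, Scheme.Hom.ker_apply] at ha
      obtain ⟨n, hn⟩ := ha
      rw [RingHom.mem_ker, map_pow] at hn
      exact IsReduced.eq_zero _ ⟨n, hn⟩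
    refine ⟨⟨IsClosedImmersion.lift (Scheme.IdealSheafData.vanishingIdeal Z).subschemeι x.1
      (by simpa using h2), ?_⟩, ?_⟩
    · rw [IsClosedImmersion.lift_fac_assoc, x.2]
    · exact Subtype.ext (IsClosedImmersion.lift_fac _ _ _)
  · rintro ⟨z, rfl⟩ p
    have := (Scheme.IdealSheafData.vanishingIdeal Z).range_subschemeι
    have h3 : (Scheme.IdealSheafData.vanishingIdeal Z).subschemeι (z.1 p) ∈
        Set.range (Scheme.IdealSheafData.vanishingIdeal Z).subschemeι := ⟨_, rfl⟩
    rw [this] at h3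
    simpa [Points.map] using h3

end Points

/-- The subset `t^{-m} K[[t]]` of `K((t))`. -/
def scaledIntegers (K : Type u) [Field K] (m : ℤ) : Set K⸨X⸩ :=
  {a | ∃ b : K⟦X⟧, a = HahnSeries.single (-m) (1 : K) * (b : K⸨X⸩)}

namespace Rectification

variable {𝔽 : Type u} [Field 𝔽] {X : Scheme.{u}} {f : X ⟶ Spec (CommRingCat.of 𝔽)}
  (R : Rectification f)

/-- The coordinates of `i_α(x)`, for a point `x` of the chart `U α`. -/
def chartCoord {F : Type u} [CommRing F] [Algebra 𝔽 F] (α : R.I)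
    (x : Points ((R.chart α).ι ≫ f) F) (j : Fin (R.dim α)) : F :=
  (x.map (R.emb α) (R.emb_over α)).coord j

/-- The ball `B_m^X` in `X(K((t)))`, that is `⋃ α, i_α⁻¹ ((t^{-m} K[[t]])^M)`. -/
def ball (K : Type u) [Field K] [Algebra 𝔽 K] (m : ℤ) : Set (Points f K⸨X⸩) :=
  {x | ∃ (α : R.I) (x' : Points ((R.chart α).ι ≫ f) K⸨X⸩),
    x'.incl (R.chart α) = x ∧ ∀ j, R.chartCoord α x' j ∈ scaledIntegers K m}

/-- The ball `B_m^X(x)`, that is the union over all `α` with `x ∈ U_α(K((t)))` of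
`i_α⁻¹ (i_α(x) + (t^{-m} K[[t]])^M)`. -/
def ballAt (K : Type u) [Field K] [Algebra 𝔽 K] (m : ℤ) (x : Points f K⸨X⸩) :
    Set (Points f K⸨X⸩) :=
  {y | ∃ (α : R.I) (x' y' : Points ((R.chart α).ι ≫ f) K⸨X⸩),
    x'.incl (R.chart α) = x ∧ y'.incl (R.chart α) = y ∧
      ∀ j, ∃ a ∈ scaledIntegers K m, R.chartCoord α y' j = R.chartCoord α x' j + a}

/-- The neighbourhood `B_m^X(Z)`, the union of the balls `B_m^X(z)` over all `z ∈ Z(K((t)))`. -/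
def ballAround (K : Type u) [Field K] [Algebra 𝔽 K] (m : ℤ) (Z : Set X) :
    Set (Points f K⸨X⸩) :=
  ⋃ z ∈ Points.In f K⸨X⸩ Z, R.ballAt K m z

end Rectification

end

/-! Let `V` be a chart of `X`, closed in `𝔸^M`, and let `x` be a point of `V` with coordinates in
`t^{-m} K[[t]]`. The closed subset `V ∖ U` is cut out in `𝔸^M` by finitely many polynomials `p`,
each either zero on `V` or with `D(p) ∩ V` inside a single chart of `U`. Fix a threshold `N`.

If some `p(x)` is not in `t^N K[[t]]`, then `x` lies in `D(p) ∩ V`. The coordinates of the chart of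
`U` are there fractions `a / p^e`, hence bounded at `x` (`exists_map_mem_ball`). If every `p(x)` is
in `t^N K[[t]]`, then `x` is an approximate zero of the equations of `V ∖ U`. For `N` large it is
within `t^m K[[t]]` of an exact zero, which is a point of `Z`.

The second case is a Greenberg approximation theorem (`hasApproximation_of_finite`), proved by
Noetherian induction on the ideal. If a product lies in the ideal, one of its factors is small at
`x` and may be adjoined. A prime ideal over a perfect field is smooth after inverting some `d`
outside it. Either `d` is small at `x` and may be adjoined, or a Newton iteration along an
infinitesimal retraction converges to a zero.

Every constant is extracted from polynomials over `𝔽` before `K` is chosen, so it is uniform in `K`.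
-/

noncomputable section

/-! ### The filtration of `K((t))` by order. -/

namespace LaurentSeries

variable (K : Type u) [Field K]

/-- The additive subgroup `t ^ n K[[t]]` of `K((t))`. -/
def fil (n : ℤ) : AddSubgroup K⸨X⸩ where
  carrier := {a | ∀ i < n, a.coeff i = 0}
  zero_mem' := fun _ _ ↦ rfl
  add_mem' := fun ha hb i hi ↦ by simp [ha i hi, hb i hi]
  neg_mem' := fun ha i hi ↦ by simp [ha i hi]

variable {K}

theorem mem_fil {n : ℤ} {a : K⸨X⸩} : a ∈ fil K n ↔ ∀ i < n, a.coeff i = 0 := Iff.rfl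

theorem mem_fil_iff_le_orderTop {n : ℤ} {a : K⸨X⸩} :
    a ∈ fil K n ↔ (n : WithTop ℤ) ≤ a.orderTop := by
  rw [mem_fil, HahnSeries.le_orderTop_iff_forall]
  simp

theorem fil_antitone : Antitone (fil K) := fun _ _ h _ ha i hi ↦ ha i (hi.trans_le h)

theorem mul_mem_fil {n m : ℤ} {a b : K⸨X⸩} (ha : a ∈ fil K n) (hb : b ∈ fil K m) :
    a * b ∈ fil K (n + m) := by
  rw [mem_fil_iff_le_orderTop] at *
  rw [HahnSeries.orderTop_mul, WithTop.coe_add]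
  exact add_le_add ha hb

/-- Orders add under multiplication. This is what splits a non-prime ideal in the approximation
theorem. -/
theorem mem_or_mem_of_mul_mem_fil {n m : ℤ} {a b : K⸨X⸩} (h : a * b ∈ fil K (n + m)) :
    a ∈ fil K n ∨ b ∈ fil K m := by
  simp only [mem_fil_iff_le_orderTop] at *
  by_contra! hc
  obtain ⟨h1, h2⟩ := hc
  rw [HahnSeries.orderTop_mul, WithTop.coe_add] at h
  lift a.orderTop to ℤ using h1.ne_top with p
  lift b.orderTop to ℤ using h2.ne_top with q
  norm_cast at *
  omega

theorem single_mem_fil (n : ℤ) (r : K) : HahnSeries.single n r ∈ fil K n := by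
  intro i hi
  exact HahnSeries.coeff_single_of_ne hi.ne

theorem one_mem_fil : (1 : K⸨X⸩) ∈ fil K 0 := single_mem_fil 0 1

theorem one_notMem_fil {n : ℤ} (hn : 0 < n) : (1 : K⸨X⸩) ∉ fil K n := fun h ↦ by
  simpa using h 0 hn

/-- Not being small bounds the inverse; all denominators below are controlled this way. -/
theorem inv_mem_fil {n : ℤ} {a : K⸨X⸩} (ha : a ∉ fil K n) : a⁻¹ ∈ fil K (-n) := by
  have h0 : a ≠ 0 := by rintro rfl; exact ha (zero_mem _)
  have h : a * a⁻¹ ∈ fil K (n + -n) := by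
    rw [mul_inv_cancel₀ h0, add_neg_cancel]
    exact one_mem_fil
  exact (mem_or_mem_of_mul_mem_fil h).resolve_left ha

theorem pow_mem_fil {n : ℤ} {a : K⸨X⸩} (ha : a ∈ fil K n) (e : ℕ) : a ^ e ∈ fil K (e * n) := by
  induction e with
  | zero => simpa using one_mem_fil
  | succ e ih =>
    rw [pow_succ]
    have := mul_mem_fil ih ha
    rwa [show (e : ℤ) * n + n = (e + 1 : ℕ) * n by push_cast; ring] at this

theorem eq_zero_of_forall_mem_fil {a : K⸨X⸩} (A : ℤ) (h : ∀ k : ℕ, a ∈ fil K (A + k)) :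
    a = 0 := by
  ext i
  exact h (i - A + 1).toNat i (by omega)

/-- Completeness of `K((t))`: each coefficient of the sequence is eventually constant. -/
theorem exists_limit (A : ℤ) (z : ℕ → K⸨X⸩) (hz : ∀ k : ℕ, z (k + 1) - z k ∈ fil K (A + k)) :
    ∃ w, ∀ k : ℕ, w - z k ∈ fil K (A + k) := by
  have hz' : ∀ k l : ℕ, k ≤ l → z l - z k ∈ fil K (A + k) := by
    intro k l hkl
    induction l, hkl using Nat.le_induction with
    | base => simp
    | succ l hl ih =>
      rw [← sub_add_sub_cancel]
      exact add_mem (fil_antitone (by omega) (hz l)) ih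
  have hc : ∀ k l : ℕ, k ≤ l → ∀ i < A + k, (z l).coeff i = (z k).coeff i := by
    intro k l hkl i hi
    have := hz' k l hkl i hi
    rwa [HahnSeries.coeff_sub, sub_eq_zero] at this
  -- The index is the least natural number `k` with `i < A + k`, from which on the coefficient at
  -- `i` no longer changes.
  let c : ℤ → K := fun i ↦ (z (i - A + 1).toNat).coeff i
  have hcz : ∀ k : ℕ, ∀ i < A + k, c i = (z k).coeff i := by
    intro k i hi
    rcases le_total k (i - A + 1).toNat with h | h
    · exact hc _ _ h i hi
    · exact (hc _ _ h i (by omega)).symm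
  have hbdd : BddBelow (Function.support c) := by
    by_cases h0 : z 0 = 0
    · refine ⟨A, fun i hi ↦ ?_⟩
      by_contra! hlt
      exact hi (by rw [hcz 0 i (by simpa using hlt), h0]; rfl)
    · refine ⟨min A (z 0).order, fun i hi ↦ ?_⟩
      by_contra! hlt
      refine hi ?_
      rw [hcz 0 i (by simpa using hlt.trans_le (min_le_left _ _))]
      exact HahnSeries.coeff_eq_zero_of_lt_order (hlt.trans_le (min_le_right _ _))
  refine ⟨HahnSeries.ofSuppBddBelow c hbdd, fun k i hi ↦ ?_⟩
  rw [HahnSeries.coeff_sub, sub_eq_zero]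
  exact hcz k i hi

/-- Elements of `𝔽` are constants in `K((t))`, so coefficients never worsen a bound. This makes the
bounds independent of `K`. -/
theorem algebraMap_mem_fil {𝔽 : Type*} [Field 𝔽] [Algebra 𝔽 K] (c : 𝔽) :
    algebraMap 𝔽 K⸨X⸩ c ∈ fil K 0 := by
  intro i hi
  rw [HahnSeries.algebraMap_apply', PowerSeries.algebraMap_apply, HahnSeries.ofPowerSeries_C]
  exact single_mem_fil 0 _ i hi

theorem mem_scaledIntegers_iff {m : ℤ} {a : K⸨X⸩} : a ∈ scaledIntegers K m ↔ a ∈ fil K (-m) := by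
  constructor
  · rintro ⟨b, rfl⟩
    have hb : (b : K⸨X⸩) ∈ fil K 0 := fun i hi ↦ ?_
    · simpa using mul_mem_fil (single_mem_fil (-m) 1) hb
    rw [PowerSeries.coeff_coe, if_pos hi]
  · intro h
    refine ⟨PowerSeries.mk fun n ↦ a.coeff (n - m), ?_⟩
    ext i
    obtain ⟨j, rfl⟩ : ∃ j, i = j + -m := ⟨i + m, by ring⟩
    rw [HahnSeries.coeff_single_mul_add, PowerSeries.coeff_coe, one_mul]
    split_ifs with hj
    · exact h _ (by omega)
    · rw [PowerSeries.coeff_mk, Int.natAbs_of_nonneg (by omega), sub_eq_add_neg]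

end LaurentSeries

/-! ### Uniform estimates for polynomials with constant coefficients. -/

namespace LaurentSeries

open MvPolynomial

variable {𝔽 : Type u} [Field 𝔽] {σ : Type}

/-- A polynomial is bounded on bounded sets, uniformly in the field of coefficients. -/
theorem exists_aeval_mem_fil (p : MvPolynomial σ 𝔽) (m : ℕ) :
    ∃ C : ℕ, ∀ (K : Type u) [Field K] [Algebra 𝔽 K] (x : σ → K⸨X⸩),
      (∀ j, x j ∈ fil K (-m)) → aeval x p ∈ fil K (-C) := by
  induction p using MvPolynomial.induction_on with
  | C a => exact ⟨0, fun K _ _ x _ ↦ by simpa using algebraMap_mem_fil a⟩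
  | add p q hp hq =>
    obtain ⟨C, hC⟩ := hp
    obtain ⟨D, hD⟩ := hq
    refine ⟨max C D, fun K _ _ x hx ↦ ?_⟩
    rw [map_add]
    exact add_mem (fil_antitone (by push_cast; omega) (hC K x hx)) (fil_antitone (by push_cast; omega) (hD K x hx))
  | mul_X p j hp =>
    obtain ⟨C, hC⟩ := hp
    refine ⟨C + m, fun K _ _ x hx ↦ ?_⟩
    rw [map_mul, aeval_X]
    exact fil_antitone (by push_cast; omega) (mul_mem_fil (hC K x hx) (hx j))

/-- A polynomial is Lipschitz on bounded sets, uniformly in the field of coefficients. -/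
theorem exists_aeval_sub_aeval_mem_fil (p : MvPolynomial σ 𝔽) (m : ℕ) :
    ∃ C : ℕ, ∀ (K : Type u) [Field K] [Algebra 𝔽 K] (x y : σ → K⸨X⸩),
      (∀ j, x j ∈ fil K (-m)) → (∀ j, y j ∈ fil K (-m)) → ∀ n : ℤ,
      (∀ j, x j - y j ∈ fil K n) → aeval x p - aeval y p ∈ fil K (n - C) := by
  induction p using MvPolynomial.induction_on with
  | C a => exact ⟨0, fun K _ _ x y _ _ n _ ↦ by simp⟩
  | add p q hp hq =>
    obtain ⟨C, hC⟩ := hp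
    obtain ⟨D, hD⟩ := hq
    refine ⟨max C D, fun K _ _ x y hx hy n h ↦ ?_⟩
    rw [map_add, map_add, add_sub_add_comm]
    exact add_mem (fil_antitone (by push_cast; omega) (hC K x y hx hy n h))
      (fil_antitone (by push_cast; omega) (hD K x y hx hy n h))
  | mul_X p j hp =>
    obtain ⟨C, hC⟩ := hp
    obtain ⟨D, hD⟩ := exists_aeval_mem_fil p m
    refine ⟨C + D + m, fun K _ _ x y hx hy n h ↦ ?_⟩
    rw [map_mul, map_mul, aeval_X, aeval_X, show aeval x p * x j - aeval y p * y j =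
      (aeval x p - aeval y p) * x j + aeval y p * (x j - y j) by ring]
    exact add_mem (fil_antitone (by push_cast; omega) (mul_mem_fil (hC K x y hx hy n h) (hx j)))
      (fil_antitone (by push_cast; omega) (mul_mem_fil (hD K y hy) (h j)))

/-- If generators of an ideal are small at a point, then so are the elements of the ideal. -/
theorem exists_aeval_mem_fil_of_mem_span {S : Set (MvPolynomial σ 𝔽)} {p : MvPolynomial σ 𝔽}
    (hp : p ∈ Ideal.span S) (m : ℕ) :
    ∃ C : ℕ, ∀ (K : Type u) [Field K] [Algebra 𝔽 K] (x : σ → K⸨X⸩),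
      (∀ j, x j ∈ fil K (-m)) → ∀ n : ℤ, (∀ g ∈ S, aeval x g ∈ fil K n) →
      aeval x p ∈ fil K (n - C) := by
  induction hp using Submodule.span_induction with
  | mem p hp => exact ⟨0, fun K _ _ x _ n h ↦ by simpa using h p hp⟩
  | zero => exact ⟨0, fun K _ _ x _ n h ↦ by simp⟩
  | add p q _ _ hp hq =>
    obtain ⟨C, hC⟩ := hp
    obtain ⟨D, hD⟩ := hq
    refine ⟨max C D, fun K _ _ x hx n h ↦ ?_⟩
    rw [map_add]
    exact add_mem (fil_antitone (by push_cast; omega) (hC K x hx n h))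
      (fil_antitone (by push_cast; omega) (hD K x hx n h))
  | smul a p _ hp =>
    obtain ⟨C, hC⟩ := hp
    obtain ⟨D, hD⟩ := exists_aeval_mem_fil a m
    refine ⟨C + D, fun K _ _ x hx n h ↦ ?_⟩
    rw [smul_eq_mul, map_mul]
    exact fil_antitone (by push_cast; omega) (mul_mem_fil (hD K x hx) (hC K x hx n h))

/-- Finitely many bounds can be made simultaneous. -/
theorem _root_.Finite.exists_nat_forall {ι : Type*} [Finite ι] {P : ι → ℕ → Prop}
    (h : ∀ i, ∃ n, P i n) (hP : ∀ i m n, m ≤ n → P i m → P i n) : ∃ n, ∀ i, P i n := by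
  cases nonempty_fintype ι
  choose f hf using h
  exact ⟨Finset.univ.sup f, fun i ↦ hP i _ _ (Finset.le_sup (Finset.mem_univ i)) (hf i)⟩

/-! ### Uniform estimates for fractions with denominator a power of `d`. -/

section Away

variable {d : MvPolynomial σ 𝔽}

/-- The evaluation of fractions with denominator a power of `d` at a point where `d` does not
vanish. -/
theorem exists_algHom_away {F : Type*} [Field F] [Algebra 𝔽 F] (x : σ → F) (h : aeval x d ≠ 0) :
    ∃ φ : Localization.Away d →ₐ[𝔽] F,
      ∀ p, φ (algebraMap (MvPolynomial σ 𝔽) _ p) = aeval x p := by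
  refine ⟨IsLocalization.liftAlgHom (M := Submonoid.powers d) (f := aeval x) ?_, fun p ↦ ?_⟩
  · rintro ⟨_, e, rfl⟩
    simpa using (IsUnit.mk0 _ h).pow e
  · simp

/-- Write `q = p / d^e`: since `d(x)` is not in `t^s K[[t]]`, the denominator costs at most `e * s`.
-/
theorem exists_algHom_away_mem_fil (q : Localization.Away d) (m s : ℕ) :
    ∃ C : ℕ, ∀ (K : Type u) [Field K] [Algebra 𝔽 K] (x : σ → K⸨X⸩)
      (φ : Localization.Away d →ₐ[𝔽] K⸨X⸩),
      (∀ p, φ (algebraMap (MvPolynomial σ 𝔽) _ p) = aeval x p) →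
      (∀ j, x j ∈ fil K (-m)) → aeval x d ∉ fil K s → φ q ∈ fil K (-C) := by
  obtain ⟨e, p, h⟩ := IsLocalization.Away.surj d q
  obtain ⟨C, hC⟩ := exists_aeval_mem_fil p m
  refine ⟨C + e * s, fun K _ _ x φ hφ hx hd ↦ ?_⟩
  have h0 : aeval x d ≠ 0 := fun h ↦ hd (h ▸ zero_mem _)
  have h1 : φ q = aeval x p * (aeval x d)⁻¹ ^ e := by
    rw [← hφ, ← h, map_mul, map_pow, hφ, mul_assoc, ← mul_pow, mul_inv_cancel₀ h0, one_pow,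
      mul_one]
  rw [h1]
  exact fil_antitone (by push_cast; linarith)
    (mul_mem_fil (hC K x hx) (pow_mem_fil (inv_mem_fil hd) e))

theorem exists_algHom_away_mem_fil_of_mem_map {S : Set (MvPolynomial σ 𝔽)}
    {q : Localization.Away d} (hq : q ∈ (Ideal.span S).map (algebraMap _ _)) (m s : ℕ) :
    ∃ C : ℕ, ∀ (K : Type u) [Field K] [Algebra 𝔽 K] (x : σ → K⸨X⸩)
      (φ : Localization.Away d →ₐ[𝔽] K⸨X⸩),
      (∀ p, φ (algebraMap (MvPolynomial σ 𝔽) _ p) = aeval x p) →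
      (∀ j, x j ∈ fil K (-m)) → aeval x d ∉ fil K s →
      ∀ n : ℤ, (∀ g ∈ S, aeval x g ∈ fil K n) → φ q ∈ fil K (n - C) := by
  rw [Ideal.map_span] at hq
  induction hq using Submodule.span_induction with
  | mem q hq =>
    obtain ⟨p, hp, rfl⟩ := hq
    exact ⟨0, fun K _ _ x φ hφ _ _ n h ↦ by simpa [hφ] using h p hp⟩
  | zero => exact ⟨0, fun K _ _ x φ _ _ _ n h ↦ by simp⟩
  | add p q _ _ hp hq =>
    obtain ⟨C, hC⟩ := hp
    obtain ⟨D, hD⟩ := hq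
    refine ⟨max C D, fun K _ _ x φ hφ hx hd n h ↦ ?_⟩
    rw [map_add]
    exact add_mem (fil_antitone (by push_cast; omega) (hC K x φ hφ hx hd n h))
      (fil_antitone (by push_cast; omega) (hD K x φ hφ hx hd n h))
  | smul a p _ hp =>
    obtain ⟨C, hC⟩ := hp
    obtain ⟨D, hD⟩ := exists_algHom_away_mem_fil a m s
    refine ⟨C + D, fun K _ _ x φ hφ hx hd n h ↦ ?_⟩
    rw [smul_eq_mul, map_mul]
    exact fil_antitone (by push_cast; omega)
      (mul_mem_fil (hD K x φ hφ hx hd) (hC K x φ hφ hx hd n h))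

/-- Each of the two factors from the ideal contributes `n` up to a constant. The resulting `2 * n`
is the quadratic gain of Newton's method. -/
theorem exists_algHom_away_mem_fil_of_mem_map_sq {S : Set (MvPolynomial σ 𝔽)}
    {q : Localization.Away d} (hq : q ∈ (Ideal.span S).map (algebraMap _ _) ^ 2) (m s : ℕ) :
    ∃ C : ℕ, ∀ (K : Type u) [Field K] [Algebra 𝔽 K] (x : σ → K⸨X⸩)
      (φ : Localization.Away d →ₐ[𝔽] K⸨X⸩),
      (∀ p, φ (algebraMap (MvPolynomial σ 𝔽) _ p) = aeval x p) →
      (∀ j, x j ∈ fil K (-m)) → aeval x d ∉ fil K s →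
      ∀ n : ℤ, (∀ g ∈ S, aeval x g ∈ fil K n) → φ q ∈ fil K (2 * n - C) := by
  rw [pow_two] at hq
  induction hq using Submodule.mul_induction_on' with
  | mem_mul_mem p hp q hq =>
    obtain ⟨C, hC⟩ := exists_algHom_away_mem_fil_of_mem_map hp m s
    obtain ⟨D, hD⟩ := exists_algHom_away_mem_fil_of_mem_map hq m s
    refine ⟨C + D, fun K _ _ x φ hφ hx hd n h ↦ ?_⟩
    rw [map_mul]
    exact fil_antitone (by push_cast; omega)
      (mul_mem_fil (hC K x φ hφ hx hd n h) (hD K x φ hφ hx hd n h))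
  | add p _ q _ hp hq =>
    obtain ⟨C, hC⟩ := hp
    obtain ⟨D, hD⟩ := hq
    refine ⟨max C D, fun K _ _ x φ hφ hx hd n h ↦ ?_⟩
    rw [map_add]
    exact add_mem (fil_antitone (by push_cast; omega) (hC K x φ hφ hx hd n h))
      (fil_antitone (by push_cast; omega) (hD K x φ hφ hx hd n h))

end Away

end LaurentSeries

/-! ### Generic smoothness and infinitesimal retractions. -/

/-- A prime ideal `p` of a polynomial ring over a perfect field becomes, after inverting a single
`d ∉ p`, the ideal of a smooth closed subscheme, so that the first infinitesimal neighbourhood of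
that subscheme retracts onto it. The retraction is given by the tuple `q`. -/
theorem MvPolynomial.exists_infinitesimal_retraction {𝔽 : Type u} [Field 𝔽] [PerfectField 𝔽]
    {σ : Type} [Finite σ] (p : Ideal (MvPolynomial σ 𝔽)) [p.IsPrime] :
    ∃ d ∉ p, ∃ q : σ → Localization.Away d,
      (∀ j, q j - algebraMap (MvPolynomial σ 𝔽) _ (MvPolynomial.X j) ∈
        p.map (algebraMap (MvPolynomial σ 𝔽) (Localization.Away d))) ∧
      ∀ g ∈ p, MvPolynomial.aeval q g ∈
        p.map (algebraMap (MvPolynomial σ 𝔽) (Localization.Away d)) ^ 2 := by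
  let A := MvPolynomial σ 𝔽 ⧸ p
  have : Algebra.FinitePresentation 𝔽 A := Algebra.FinitePresentation.of_finiteType.mp inferInstance
  -- The local ring at the generic point is the fraction field of `A`, essentially of finite type
  -- over a perfect field and hence formally smooth. Smoothness then spreads to a basic open set.
  have : Algebra.IsSmoothAt 𝔽 (⊥ : Ideal A) := by
    have h0 : (⊥ : Ideal A).primeCompl = nonZeroDivisors A := by
      ext x; simp [Ideal.primeCompl]
    have : IsFractionRing A (Localization.AtPrime (⊥ : Ideal A)) := by
      change IsLocalization _ _
      rw [← h0]
      infer_instance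
    let : Field (Localization.AtPrime (⊥ : Ideal A)) := IsFractionRing.toField A
    have : Algebra.EssFiniteType 𝔽 (Localization.AtPrime (⊥ : Ideal A)) :=
      Algebra.EssFiniteType.comp 𝔽 A _
    exact Algebra.FormallySmooth.of_perfectField
  obtain ⟨d', hd', hs⟩ := Algebra.IsSmoothAt.exists_notMem_smooth 𝔽 (⊥ : Ideal A)
  obtain ⟨d, rfl⟩ := Ideal.Quotient.mk_surjective d'
  have hd : d ∉ p := fun h ↦ hd' (Ideal.Quotient.eq_zero_iff_mem.mpr h)
  refine ⟨d, hd, ?_⟩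
  let Q := Localization.Away d
  let I : Ideal Q := p.map (algebraMap (MvPolynomial σ 𝔽) Q)
  have hloc : IsLocalization.Away (Ideal.Quotient.mk p d) (Q ⧸ I) := by
    have : IsLocalization (Algebra.algebraMapSubmonoid A (Submonoid.powers d)) (Q ⧸ I) :=
      inferInstance
    rwa [Algebra.algebraMapSubmonoid_powers] at this
  have : IsScalarTower 𝔽 A (Q ⧸ I) := 
    IsScalarTower.of_algebraMap_eq (R := 𝔽) (S := A) (A := Q ⧸ I) fun r ↦
      congrArg (Ideal.Quotient.mk I) (IsScalarTower.algebraMap_apply 𝔽 (MvPolynomial σ 𝔽) Q r)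
  have : Algebra.FormallySmooth 𝔽 (Q ⧸ I) :=
    Algebra.FormallySmooth.of_equiv ((IsLocalization.algEquiv
      (Submonoid.powers (Ideal.Quotient.mk p d)) (Localization.Away (Ideal.Quotient.mk p d))
      (Q ⧸ I)).restrictScalars 𝔽)
  have hI : I ^ 2 ≤ I := Ideal.pow_le_self two_ne_zero
  let g : (Q ⧸ I ^ 2) →ₐ[𝔽] Q ⧸ I := Ideal.Quotient.factorₐ 𝔽 hI
  have hg : Function.Surjective g := Ideal.Quotient.factor_surjective hI
  have hker : RingHom.ker (g : (Q ⧸ I ^ 2) →+* Q ⧸ I) = I.map (Ideal.Quotient.mk _) :=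
    Ideal.Quotient.factor_ker hI
  have hnil : IsNilpotent (RingHom.ker (g : (Q ⧸ I ^ 2) →+* Q ⧸ I)) := by
    refine ⟨2, ?_⟩
    rw [hker]
    exact (Ideal.map_pow _ I 2).symm.trans (Ideal.map_quotient_self (I ^ 2))
  -- The kernel of `g` is `I / I²`, of square zero, so formal smoothness lifts the identity to a
  -- section of `g`. Representatives of the images of the variables under `s` give `q`.
  let s : (Q ⧸ I) →ₐ[𝔽] Q ⧸ I ^ 2 :=
    Algebra.FormallySmooth.liftOfSurjective (AlgHom.id 𝔽 _) g hg hnil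
  have hgs : ∀ x, g (s x) = x := fun x ↦
    Algebra.FormallySmooth.liftOfSurjective_apply (AlgHom.id 𝔽 _) g hg hnil x
  let x (j : σ) : Q := algebraMap (MvPolynomial σ 𝔽) _ (MvPolynomial.X j)
  choose q hq using fun j ↦ Ideal.Quotient.mk_surjective (s (Ideal.Quotient.mk I (x j)))
  refine ⟨q, fun j ↦ ?_, fun f hf ↦ ?_⟩
  · rw [← Ideal.Quotient.mk_eq_mk_iff_sub_mem]
    have := hgs (Ideal.Quotient.mk I (x j))
    rw [← hq] at this
    exact this
  · rw [← Ideal.Quotient.eq_zero_iff_mem]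
    -- Modulo `I²`, substituting `q` is reduction modulo `I` followed by `s`, so it kills `p`.
    have h1 : (Ideal.Quotient.mkₐ 𝔽 (I ^ 2)).comp (MvPolynomial.aeval q) =
        (s.comp (Ideal.Quotient.mkₐ 𝔽 I)).comp (IsScalarTower.toAlgHom 𝔽 (MvPolynomial σ 𝔽) Q) :=
      MvPolynomial.algHom_ext fun j ↦ by
        rw [AlgHom.comp_apply, MvPolynomial.aeval_X]
        exact hq j
    have h2 : Ideal.Quotient.mk I (algebraMap (MvPolynomial σ 𝔽) Q f) = 0 :=
      Ideal.Quotient.eq_zero_iff_mem.mpr (Ideal.mem_map_of_mem _ hf)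
    have h3 := congr($h1 f)
    rw [AlgHom.comp_apply, AlgHom.comp_apply, AlgHom.comp_apply] at h3
    exact h3.trans ((congrArg s h2).trans (map_zero s))

/-! ### Newton iteration and the approximation theorem. -/

namespace LaurentSeries

open MvPolynomial

variable {𝔽 : Type u} [Field 𝔽] {σ : Type}

/-- Newton approximation: if `q` is an infinitesimal retraction onto the zero locus of `S`, then
iterating `q` leads from an approximate zero of `S`, at which `d` is not small, to a zero. -/
theorem exists_zero_of_infinitesimal_retraction [Finite σ] {S : Set (MvPolynomial σ 𝔽)}
    (hS : S.Finite) {d : MvPolynomial σ 𝔽} {q : σ → Localization.Away d}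
    (hq : ∀ j, q j - algebraMap (MvPolynomial σ 𝔽) _ (MvPolynomial.X j) ∈
      (Ideal.span S).map (algebraMap _ _))
    (hqS : ∀ g ∈ S, MvPolynomial.aeval q g ∈ (Ideal.span S).map (algebraMap _ _) ^ 2)
    (m r s : ℕ) :
    ∃ N : ℕ, ∀ (K : Type u) [Field K] [Algebra 𝔽 K] (x : σ → K⸨X⸩),
      (∀ j, x j ∈ fil K (-m)) → aeval x d ∉ fil K s → (∀ g ∈ S, aeval x g ∈ fil K N) →
      ∃ z : σ → K⸨X⸩, (∀ g ∈ S, aeval z g = 0) ∧ ∀ j, x j - z j ∈ fil K r := by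
  have : Finite S := hS
  obtain ⟨C₁, hC₁⟩ := Finite.exists_nat_forall
    (fun j ↦ exists_algHom_away_mem_fil_of_mem_map (hq j) m s)
    fun j a b hab h K _ _ x φ hφ hx hd n hn ↦ fil_antitone (by omega) (h K x φ hφ hx hd n hn)
  obtain ⟨C₂, hC₂⟩ := Finite.exists_nat_forall
    (fun g : S ↦ exists_algHom_away_mem_fil_of_mem_map_sq (hqS g g.2) m s)
    fun j a b hab h K _ _ x φ hφ hx hd n hn ↦ fil_antitone (by omega) (h K x φ hφ hx hd n hn)
  obtain ⟨C₃, hC₃⟩ := exists_aeval_sub_aeval_mem_fil d m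
  obtain ⟨C₄, hC₄⟩ := Finite.exists_nat_forall
    (fun g : S ↦ exists_aeval_sub_aeval_mem_fil (g : MvPolynomial σ 𝔽) m)
    fun j a b hab h K _ _ x y hx hy n hn ↦ fil_antitone (by omega) (h K x y hx hy n hn)
  -- Large enough that a displacement in `t^(N - C₁)` keeps the point bounded, changes `d` only
  -- within `t^s` and stays within `t^r`, and that `2 * (N + k) - C₂ ≥ N + k + 1`. The constant `C₄`
  -- is absent because it is absorbed in the limit.
  let N : ℕ := C₁ + C₂ + C₃ + s + r + 1
  refine ⟨N, fun K _ _ x hx hd hxS ↦ ?_⟩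
  -- Gaining one order per step suffices for convergence, so only this much of the quadratic gain is
  -- recorded.
  let Good (k : ℕ) (x : σ → K⸨X⸩) : Prop := (∀ j, x j ∈ fil K (-m)) ∧ aeval x d ∉ fil K s ∧
    ∀ g ∈ S, aeval x g ∈ fil K ((N + k : ℕ) : ℤ)
  have step (k : ℕ) (x : σ → K⸨X⸩) (h : Good k x) :
      ∃ y, Good (k + 1) y ∧ ∀ j, y j - x j ∈ fil K ((N - C₁ : ℤ) + k) := by
    obtain ⟨hx, hd, hxS⟩ := h
    -- The Newton step sends `x` to the value of the tuple `q` at `x`.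
    obtain ⟨φ, hφ⟩ := exists_algHom_away (d := d) x (fun h ↦ hd (h ▸ zero_mem _))
    have hclose (j) : φ (q j) - x j ∈ fil K ((N + k : ℕ) - C₁ : ℤ) := by
      have := hC₁ j K x φ hφ hx hd _ hxS
      rwa [map_sub, hφ, aeval_X] at this
    have hbdd (j) : φ (q j) ∈ fil K (-m) := by
      rw [← sub_add_cancel (φ (q j)) (x j)]
      exact add_mem (fil_antitone (by omega) (hclose j)) (hx j)
    refine ⟨fun j ↦ φ (q j), ⟨hbdd, fun h ↦ hd ?_, fun g hg ↦ ?_⟩, fun j ↦ ?_⟩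
    · rw [← sub_sub_cancel (aeval (fun j ↦ φ (q j)) d) (aeval x d)]
      exact sub_mem h (fil_antitone (by omega) (hC₃ K _ x hbdd hx _ hclose))
    · have h1 : aeval (fun j ↦ φ (q j)) g = φ (aeval q g) := by
        rw [← comp_aeval]; rfl
      rw [h1]
      exact fil_antitone (by omega) (hC₂ ⟨g, hg⟩ K x φ hφ hx hd _ hxS)
    · exact fil_antitone (by omega) (hclose j)
  choose! next hnext using step
  let seq : ℕ → σ → K⸨X⸩ := Nat.rec x next
  have hgood (k) : Good k (seq k) := by
    induction k with
    | zero => exact ⟨hx, hd, hxS⟩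
    | succ k ih => exact (hnext k _ ih).1
  choose z hz using fun j ↦ exists_limit (N - C₁ : ℤ) (fun k ↦ seq k j)
    fun k ↦ (hnext k _ (hgood k)).2 j
  have hzx (j) : x j - z j ∈ fil K (N - C₁ : ℤ) := by
    have h := neg_mem (hz j 0)
    rwa [neg_sub, Nat.cast_zero, add_zero] at h
  have hbdd (j) : z j ∈ fil K (-m) := by
    rw [← sub_sub_cancel (x j) (z j)]
    exact sub_mem (hx j) (fil_antitone (by omega) (hzx j))
  -- For each `k`, `g z` differs from the small value `g (seq k)` by an element of order at least `N
  -- - C₁ + k - C₄`; let `k` grow.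
  refine ⟨z, fun g hg ↦ eq_zero_of_forall_mem_fil (N - C₁ - C₄) fun k ↦ ?_,
    fun j ↦ fil_antitone (by omega) (hzx j)⟩
  rw [← sub_add_cancel (aeval z g) (aeval (seq k) g)]
  exact add_mem
    (fil_antitone (by omega) (hC₄ ⟨g, hg⟩ K z (seq k) hbdd (hgood k).1 _ (fun j ↦ hz j k)))
    (fil_antitone (by omega) ((hgood k).2.2 g hg))

/-- Approximate zeros of `S` over `K((t))` are close to zeros, uniformly in the field `K`. -/
def HasApproximation (S : Set (MvPolynomial σ 𝔽)) : Prop :=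
  ∀ m r : ℕ, ∃ N : ℕ, ∀ (K : Type u) [Field K] [Algebra 𝔽 K] (x : σ → K⸨X⸩),
    (∀ j, x j ∈ fil K (-m)) → (∀ g ∈ S, aeval x g ∈ fil K N) →
    ∃ z : σ → K⸨X⸩, (∀ g ∈ S, aeval z g = 0) ∧ ∀ j, x j - z j ∈ fil K r

/-- There are no bounded approximate zeros: at accuracy `C + 1` the constant `1` would have positive
order. -/
theorem hasApproximation_of_one_mem_span {S : Set (MvPolynomial σ 𝔽)} (h : 1 ∈ Ideal.span S) :
    HasApproximation S := by
  intro m r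
  obtain ⟨C, hC⟩ := exists_aeval_mem_fil_of_mem_span h m
  refine ⟨C + 1, fun K _ _ x hx hxS ↦ (one_notMem_fil (K := K) zero_lt_one ?_).elim⟩
  have := hC K x hx _ hxS
  rw [map_one] at this
  exact fil_antitone (by omega) this

theorem HasApproximation.of_mul_mem_span {S : Set (MvPolynomial σ 𝔽)} {a b : MvPolynomial σ 𝔽}
    (hab : a * b ∈ Ideal.span S) (ha : HasApproximation (insert a S))
    (hb : HasApproximation (insert b S)) : HasApproximation S := by
  intro m r
  obtain ⟨N₁, h₁⟩ := ha m r
  obtain ⟨N₂, h₂⟩ := hb m r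
  obtain ⟨C, hC⟩ := exists_aeval_mem_fil_of_mem_span hab m
  refine ⟨N₁ + N₂ + C, fun K _ _ x hx hxS ↦ ?_⟩
  have h : aeval x a * aeval x b ∈ fil K (N₁ + N₂ : ℤ) := by
    rw [← map_mul]
    exact fil_antitone (by omega) (hC K x hx _ hxS)
  obtain h | h := mem_or_mem_of_mul_mem_fil h
  · obtain ⟨z, hz, hxz⟩ := h₁ K x hx (Set.forall_mem_insert.mpr
      ⟨h, fun g hg ↦ fil_antitone (by omega) (hxS g hg)⟩)
    exact ⟨z, fun g hg ↦ hz g (Set.mem_insert_of_mem _ hg), hxz⟩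
  · obtain ⟨z, hz, hxz⟩ := h₂ K x hx (Set.forall_mem_insert.mpr
      ⟨h, fun g hg ↦ fil_antitone (by omega) (hxS g hg)⟩)
    exact ⟨z, fun g hg ↦ hz g (Set.mem_insert_of_mem _ hg), hxz⟩

/-- A version of Greenberg's approximation theorem for equations with constant coefficients. -/
theorem hasApproximation_of_finite [PerfectField 𝔽] [Finite σ] {S : Set (MvPolynomial σ 𝔽)}
    (hS : S.Finite) : HasApproximation S := by
  -- Induction is on the ideal, with the finite generating set left free, because adjoining an
  -- element changes both.
  suffices H : ∀ (I : Ideal (MvPolynomial σ 𝔽)) (S : Set (MvPolynomial σ 𝔽)), S.Finite →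
      Ideal.span S = I → HasApproximation S from H _ S hS rfl
  intro I
  induction I using IsNoetherian.induction with
  | hgt I ih =>
  rintro S hS rfl
  have hins (a) (ha : a ∉ Ideal.span S) : HasApproximation (insert a S) := by
    refine ih _ ?_ _ (hS.insert a) rfl
    refine lt_of_le_of_ne (Ideal.span_mono (Set.subset_insert _ _)) fun h ↦ ha ?_
    rw [h]
    exact Ideal.subset_span (Set.mem_insert _ _)
  by_cases htop : Ideal.span S = ⊤
  · exact hasApproximation_of_one_mem_span (htop ▸ Submodule.mem_top)
  by_cases hp : (Ideal.span S).IsPrime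
  · obtain ⟨d, hd, q, hq, hqS⟩ := exists_infinitesimal_retraction (Ideal.span S)
    intro m r
    -- The accuracy required for `insert d S` serves as the threshold for `d` to be small; the
    -- Newton accuracy is then chosen in terms of it.
    obtain ⟨s, hs⟩ := hins d hd m r
    obtain ⟨N, hN⟩ := exists_zero_of_infinitesimal_retraction hS hq
      (fun g hg ↦ hqS g (Ideal.subset_span hg)) m r s
    refine ⟨max N s, fun K _ _ x hx hxS ↦ ?_⟩
    by_cases h : aeval x d ∈ fil K s
    · obtain ⟨z, hz, hxz⟩ := hs K x hx (Set.forall_mem_insert.mpr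
        ⟨h, fun g hg ↦ fil_antitone (by omega) (hxS g hg)⟩)
      exact ⟨z, fun g hg ↦ hz g (Set.mem_insert_of_mem _ hg), hxz⟩
    · exact hN K x hx h fun g hg ↦ fil_antitone (by omega) (hxS g hg)
  · rw [Ideal.isPrime_iff] at hp
    push Not at hp
    obtain ⟨a, b, hab, ha, hb⟩ := hp htop
    exact .of_mul_mem_span hab (hins a ha) (hins b hb)

end LaurentSeries

/-! ### Points as evaluation homomorphisms. -/

/-- The structure map `𝔽 → Γ(X, ⊤)` of an `𝔽`-scheme. -/
def constHom {𝔽 : Type u} [Field 𝔽] {X : Scheme.{u}} (f : X ⟶ Spec (CommRingCat.of 𝔽)) :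
    𝔽 →+* Γ(X, ⊤) :=
  ((Scheme.ΓSpecIso (CommRingCat.of 𝔽)).inv ≫ f.appTop).hom

namespace Points

variable {𝔽 : Type u} [Field 𝔽] {X Y : Scheme.{u}} {f : X ⟶ Spec (CommRingCat.of 𝔽)}

section CommRing

variable {F : Type u} [CommRing F] [Algebra 𝔽 F]

/-- The value of a global function at a point. -/
def eval (x : Points f F) : Γ(X, ⊤) →+* F :=
  (x.1.appTop ≫ (Scheme.ΓSpecIso (CommRingCat.of F)).hom).hom

theorem eval_map (g : X ⟶ Y) {f' : Y ⟶ Spec (CommRingCat.of 𝔽)} (h : g ≫ f' = f)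
    (x : Points f F) (a : Γ(Y, ⊤)) : (x.map g h).eval a = x.eval (g.appTop a) := by
  simp only [eval, map, Scheme.Hom.comp_appTop, Category.assoc]
  rfl

theorem eval_constHom (x : Points f F) (c : 𝔽) : x.eval (constHom f c) = algebraMap 𝔽 F c := by
  have h : (Scheme.ΓSpecIso (CommRingCat.of 𝔽)).inv ≫ f.appTop ≫ x.1.appTop ≫
      (Scheme.ΓSpecIso (CommRingCat.of F)).hom = CommRingCat.ofHom (algebraMap 𝔽 F) := by
    rw [← Scheme.Hom.comp_appTop_assoc, x.2, Iso.inv_comp_eq, Scheme.ΓSpecIso_naturality]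
  exact congr($h c)

/-- An affine `X` is the spectrum of its global functions; compatibility with constants says that
the resulting morphism is over `𝔽`. -/
theorem exists_eval_eq [IsAffine X] (φ : Γ(X, ⊤) →+* F)
    (hφ : ∀ c, φ (constHom f c) = algebraMap 𝔽 F c) : ∃ x : Points f F, x.eval = φ := by
  have key : (Spec.map (CommRingCat.ofHom φ) ≫ X.isoSpec.inv).appTop ≫
      (Scheme.ΓSpecIso (CommRingCat.of F)).hom = CommRingCat.ofHom φ := by
    have h : X.isoSpec.inv.appTop = (Scheme.ΓSpecIso Γ(X, ⊤)).inv := by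
      rw [← Iso.hom_comp_eq_id, ← Scheme.toSpecΓ_appTop, ← Scheme.Hom.comp_appTop,
        Scheme.isoSpec_inv_toSpecΓ, Scheme.Hom.id_appTop]
    rw [Scheme.Hom.comp_appTop, Category.assoc, Scheme.ΓSpecIso_naturality, h]
    exact Iso.inv_hom_id_assoc _ _
  refine ⟨⟨Spec.map (CommRingCat.ofHom φ) ≫ X.isoSpec.inv, ?_⟩, ?_⟩
  · apply ext_of_isAffine
    rw [← cancel_mono (Scheme.ΓSpecIso _).hom, ← cancel_epi (Scheme.ΓSpecIso _).inv,
      Scheme.ΓSpecIso_naturality, Iso.inv_hom_id_assoc, Scheme.Hom.comp_appTop, Category.assoc, key]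
    ext c
    exact hφ c
  · exact congrArg CommRingCat.Hom.hom key

end CommRing

section Field

variable {F : Type u} [Field F] [Algebra 𝔽 F]

/-- Over a field the pulled back function is zero or a unit, so its basic open in `Spec F` is empty
or everything. -/
theorem mem_basicOpen_iff (x : Points f F) (h : Γ(X, ⊤)) (p) :
    x.1 p ∈ X.basicOpen h ↔ x.eval h ≠ 0 := by
  have h1 : x.1 p ∈ X.basicOpen h ↔ p ∈ (Spec (CommRingCat.of F)).basicOpen (x.1.appTop h) := by
    rw [← Scheme.preimage_basicOpen_top]; rfl
  rw [h1]
  constructor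
  · intro hp h0
    have : x.1.appTop h = 0 :=
      (ConcreteCategory.bijective_of_isIso (Scheme.ΓSpecIso (CommRingCat.of F)).hom).1
        (h0.trans (map_zero _).symm)
    rw [this] at hp
    simp at hp
  · intro h0
    have : IsUnit (x.1.appTop h) :=
      (isUnit_map_iff (Scheme.ΓSpecIso (CommRingCat.of F)).commRingCatIsoToRingEquiv _).mp
        (IsUnit.mk0 _ h0)
    rw [Scheme.basicOpen_of_isUnit _ this]
    trivial

/-- A point lifts along an open immersion whose range contains it. -/
theorem exists_map_eq_of_isOpenImmersion (g : Y ⟶ X) [IsOpenImmersion g] (x : Points f F)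
    (h : ∀ p, x.1 p ∈ g.opensRange) : ∃ y : Points (g ≫ f) F, y.map g rfl = x := by
  have h' : Set.range x.1 ⊆ Set.range g := by
    rintro _ ⟨p, rfl⟩
    exact h p
  refine ⟨⟨IsOpenImmersion.lift g x.1 h', ?_⟩, Subtype.ext (IsOpenImmersion.lift_fac _ _ _)⟩
  rw [IsOpenImmersion.lift_fac_assoc, x.2]

end Field

end Points

/-- A function on a basic open of an affine scheme is a fraction of global functions. -/
theorem exists_mul_pow_eq_of_basicOpen {X : Scheme.{u}} [IsAffine X] (h : Γ(X, ⊤))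
    (b : Γ((X.basicOpen h).toScheme, ⊤)) :
    ∃ (e : ℕ) (a : Γ(X, ⊤)),
      b * (X.basicOpen h).ι.appTop h ^ e = (X.basicOpen h).ι.appTop a := by
  obtain ⟨e, a, hea⟩ := exists_eq_pow_mul_of_isAffineOpen X ⊤ (isAffineOpen_top X) h
    ((X.basicOpen h).topIso.hom b)
  refine ⟨e, a, ?_⟩
  apply (ConcreteCategory.bijective_of_isIso (X.basicOpen h).topIso.hom).1
  rw [map_mul, map_pow]
  have h1 (c : Γ(X, ⊤)) : (X.basicOpen h).topIso.hom ((X.basicOpen h).ι.appTop c) =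
      c |_ X.basicOpen h := by
    have : (X.basicOpen h).ι.appTop ≫ (X.basicOpen h).topIso.hom =
        X.presheaf.map (homOfLE le_top).op := by
      rw [Scheme.Opens.ι_appTop, Scheme.Opens.topIso_hom]
      exact (X.presheaf.map_comp _ _).symm
    exact congr($this c)
  rw [h1, h1, hea, mul_comm]

/-- A closed immersion into an affine scheme is surjective on global functions, and those of `𝔸^M`
are polynomials. Renaming variables only removes the `ULift`. -/
theorem AffSpace.eval₂Hom_coord_surjective {𝔽 : Type u} [Field 𝔽] {X : Scheme.{u}}
    (f : X ⟶ Spec (CommRingCat.of 𝔽)) {M : ℕ} (i : X ⟶ AffSpace 𝔽 M) [IsClosedImmersion i]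
    (hi : i ≫ AffSpace.str 𝔽 M = f) :
    Function.Surjective (MvPolynomial.eval₂Hom (constHom f)
      fun j : Fin M ↦ i.appTop (AffineSpace.coord (Spec (CommRingCat.of 𝔽)) (ULift.up j))) := by
  have h1 : Function.Surjective i.appTop :=
    (IsClosedImmersion.isAffine_surjective_of_isAffine i).2
  let e := AffineSpace.SpecIso (ULift.{u} (Fin M)) (CommRingCat.of 𝔽)
  intro a
  obtain ⟨b, rfl⟩ := h1 a
  have hb : e.hom.appTop (e.inv.appTop b) = b := by
    have : e.inv.appTop ≫ e.hom.appTop = 𝟙 _ := by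
      rw [← Scheme.Hom.comp_appTop, Iso.hom_inv_id, Scheme.Hom.id_appTop]
    exact congr($this b)
  obtain ⟨p, hp⟩ := (MvPolynomial.renameEquiv 𝔽 Equiv.ulift.symm).surjective
    ((Scheme.ΓSpecIso _).hom (e.inv.appTop b) : MvPolynomial (ULift.{u} (Fin M)) 𝔽)
  refine ⟨p, ?_⟩
  rw [← hb, AffineSpace.SpecIso_hom_appTop, CommRingCat.comp_apply, ← hp]
  have : MvPolynomial.eval₂Hom (constHom f)
      (fun j : Fin M ↦ i.appTop (AffineSpace.coord (Spec (CommRingCat.of 𝔽)) (ULift.up j))) =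
      i.appTop.hom.comp ((MvPolynomial.eval₂Hom ((Scheme.ΓSpecIso _).inv ≫
        (AffSpace.str 𝔽 M).appTop).hom (AffineSpace.coord _)).comp
          (MvPolynomial.rename Equiv.ulift.symm).toRingHom) := by
    apply MvPolynomial.ringHom_ext
    · intro c
      simp [constHom, ← hi]
      rfl
    · intro j
      simp
  exact congr($this p)

/-! ### Bounds for regular functions at bounded points. -/

open LaurentSeries

/-- The restriction to `X` of a coordinate of affine space, along a morphism `X ⟶ 𝔸^M`. -/
def AffSpace.coordFn {𝔽 : Type u} [Field 𝔽] {X : Scheme.{u}} {M : ℕ} (i : X ⟶ AffSpace 𝔽 M)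
    (j : Fin M) : Γ(X, ⊤) :=
  i.appTop (AffineSpace.coord (Spec (CommRingCat.of 𝔽)) (ULift.up j))

/-- The restriction of polynomial functions along a morphism `X ⟶ 𝔸^M`. -/
def AffSpace.polyFn {𝔽 : Type u} [Field 𝔽] {X : Scheme.{u}} (f : X ⟶ Spec (CommRingCat.of 𝔽))
    {M : ℕ} (i : X ⟶ AffSpace 𝔽 M) : MvPolynomial (Fin M) 𝔽 →+* Γ(X, ⊤) :=
  MvPolynomial.eval₂Hom (constHom f) (AffSpace.coordFn i)

namespace Points

variable {𝔽 : Type u} [Field 𝔽] {X : Scheme.{u}} {f : X ⟶ Spec (CommRingCat.of 𝔽)} {M : ℕ}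

theorem eval_polyFn {F : Type u} [CommRing F] [Algebra 𝔽 F] (i : X ⟶ AffSpace 𝔽 M)
    (x : Points f F) (p : MvPolynomial (Fin M) 𝔽) :
    x.eval (AffSpace.polyFn f i p) =
      MvPolynomial.aeval (fun j ↦ x.eval (AffSpace.coordFn i j)) p := by
  have : x.eval.comp (AffSpace.polyFn f i) =
      (MvPolynomial.aeval (fun j ↦ x.eval (AffSpace.coordFn i j))).toRingHom := by
    apply MvPolynomial.ringHom_ext
    · intro c
      simpa [AffSpace.polyFn] using x.eval_constHom c
    · intro j
      simp [AffSpace.polyFn]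
  exact congr($this p)

theorem coord_map {F : Type u} [CommRing F] [Algebra 𝔽 F] (i : X ⟶ AffSpace 𝔽 M)
    (hi : i ≫ AffSpace.str 𝔽 M = f) (x : Points f F) (j : Fin M) :
    (x.map i hi).coord j = x.eval (AffSpace.coordFn i j) :=
  x.eval_map i hi _

theorem exists_eval_mem_fil (i : X ⟶ AffSpace 𝔽 M) [IsClosedImmersion i]
    (hi : i ≫ AffSpace.str 𝔽 M = f) (a : Γ(X, ⊤)) (m : ℕ) :
    ∃ C : ℕ, ∀ (K : Type u) [Field K] [Algebra 𝔽 K] (x : Points f K⸨X⸩),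
      (∀ j, x.eval (AffSpace.coordFn i j) ∈ fil K (-m)) → x.eval a ∈ fil K (-C) := by
  obtain ⟨p, rfl⟩ := AffSpace.eval₂Hom_coord_surjective f i hi a
  obtain ⟨C, hC⟩ := exists_aeval_mem_fil p m
  refine ⟨C, fun K _ _ x hx ↦ ?_⟩
  have := hC K _ hx
  rwa [← eval_polyFn] at this

/-- A function on `D(h)` is `a / h^e` with `a` a polynomial in the coordinates. This allows the
comparison with an unrelated embedding of an open subset. -/
theorem exists_eval_basicOpen_mem_fil (i : X ⟶ AffSpace 𝔽 M) [IsClosedImmersion i]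
    (hi : i ≫ AffSpace.str 𝔽 M = f) (h : Γ(X, ⊤)) (b : Γ((X.basicOpen h).toScheme, ⊤)) (m s : ℕ) :
    ∃ C : ℕ, ∀ (K : Type u) [Field K] [Algebra 𝔽 K] (x : Points ((X.basicOpen h).ι ≫ f) K⸨X⸩),
      (∀ j, (x.incl _).eval (AffSpace.coordFn i j) ∈ fil K (-m)) →
      (x.incl _).eval h ∉ fil K s → x.eval b ∈ fil K (-C) := by
  have : IsAffine X := (IsClosedImmersion.isAffine_surjective_of_isAffine i).1
  obtain ⟨e, a, hba⟩ := exists_mul_pow_eq_of_basicOpen h b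
  obtain ⟨C, hC⟩ := exists_eval_mem_fil i hi a m
  refine ⟨C + e * s, fun K _ _ x hx hs ↦ ?_⟩
  have h0 : (x.incl _).eval h ≠ 0 := fun h ↦ hs (h ▸ zero_mem _)
  have h1 := congrArg x.eval hba
  rw [map_mul, map_pow, ← eval_map _ rfl, ← eval_map _ rfl] at h1
  have h2 : x.eval b = (x.incl _).eval a * ((x.incl _).eval h)⁻¹ ^ e := by
    rw [inv_pow, eq_mul_inv_iff_mul_eq₀ (pow_ne_zero e h0)]
    exact h1
  rw [h2]
  exact fil_antitone (by push_cast; linarith)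
    (mul_mem_fil (hC K _ hx) (pow_mem_fil (inv_mem_fil hs) e))

end Points

/-! ### Comparison of the two rectifications. -/

namespace Rectification

variable {𝔽 : Type u} [Field 𝔽] {X : Scheme.{u}} {f : X ⟶ Spec (CommRingCat.of 𝔽)}

theorem chartCoord_eq_eval (R : Rectification f) {F : Type u} [CommRing F] [Algebra 𝔽 F] (α : R.I)
    (x : Points ((R.chart α).ι ≫ f) F) (j : Fin (R.dim α)) :
    R.chartCoord α x j = x.eval (AffSpace.coordFn (R.emb α) j) :=
  x.coord_map _ _ j

theorem ball_mono (R : Rectification f) (K : Type u) [Field K] [Algebra 𝔽 K] :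
    Monotone (R.ball K) := by
  rintro m n hmn _ ⟨α, x, rfl, hx⟩
  refine ⟨α, x, rfl, fun j ↦ ?_⟩
  have := hx j
  rw [mem_scaledIntegers_iff] at this ⊢
  exact fil_antitone (by omega) this

/-- A bounded part of an affine open subscheme on which a function `h` is not small lies in a ball
of any chart that contains the locus where `h` is invertible. -/
theorem exists_map_mem_ball {U : X.Opens} (RU : Rectification (U.ι ≫ f)) {V : Scheme.{u}}
    (v : V ⟶ X) {M : ℕ} (i : V ⟶ AffSpace 𝔽 M) [IsClosedImmersion i]
    (hi : i ≫ AffSpace.str 𝔽 M = v ≫ f) (h : Γ(V, ⊤)) (β : RU.I)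
    (hβ : ∀ p ∈ V.basicOpen h, v p ∈ U.ι ''ᵁ RU.chart β) (m s : ℕ) :
    ∃ C : ℕ, ∀ (K : Type u) [Field K] [Algebra 𝔽 K] (x : Points (v ≫ f) K⸨X⸩),
      (∀ j, x.eval (AffSpace.coordFn i j) ∈ fil K (-m)) → x.eval h ∉ fil K s →
      x.map v rfl ∈ Points.incl U '' RU.ball K C := by
  let w : (RU.chart β).toScheme ⟶ X := (RU.chart β).ι ≫ U.ι
  have hw : Set.range ((V.basicOpen h).ι ≫ v) ⊆ Set.range w := by
    rintro _ ⟨p, rfl⟩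
    obtain ⟨q, hq, hqp⟩ := hβ _ p.2
    exact ⟨⟨q, hq⟩, hqp⟩
  -- The inclusion of `D(h)` factors through the chart `β`, whose coordinates thus become functions
  -- on `D(h)`.
  let ρ := IsOpenImmersion.lift w ((V.basicOpen h).ι ≫ v) hw
  have hρ : ρ ≫ w = (V.basicOpen h).ι ≫ v := IsOpenImmersion.lift_fac _ _ _
  obtain ⟨C, hC⟩ := Finite.exists_nat_forall
    (fun j ↦ Points.exists_eval_basicOpen_mem_fil i hi h
      (ρ.appTop (AffSpace.coordFn (RU.emb β) j)) m s)
    fun j a b hab h K _ _ x hx hs ↦ fil_antitone (by omega) (h K x hx hs)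
  refine ⟨C, fun K _ _ x hx hs ↦ ?_⟩
  have h0 : x.eval h ≠ 0 := fun h ↦ hs (h ▸ zero_mem _)
  obtain ⟨y, rfl⟩ := x.exists_map_eq_of_isOpenImmersion (V.basicOpen h).ι fun p ↦ by
    simpa using (x.mem_basicOpen_iff h p).mpr h0
  let y' : Points ((RU.chart β).ι ≫ U.ι ≫ f) K⸨X⸩ := y.map ρ (by
    rw [← Category.assoc _ U.ι, ← Category.assoc, hρ, Category.assoc])
  refine ⟨y'.incl _, ⟨β, y', rfl, fun j ↦ ?_⟩, Subtype.ext ?_⟩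
  · rw [mem_scaledIntegers_iff, chartCoord_eq_eval, Points.eval_map]
    exact hC j K y hx hs
  · simpa [Points.incl, Points.map, y', w] using congr(y.1 ≫ $hρ)

/-- The claim for a single chart of the rectification of `X`. -/
theorem exists_mem_ball_or_mem_ballAround [PerfectField 𝔽] (R : Rectification f) {U : X.Opens}
    (RU : Rectification (U.ι ≫ f)) (α : R.I) (m : ℕ) :
    ∃ C : ℕ, ∀ (K : Type u) [Field K] [Algebra 𝔽 K] (x : Points ((R.chart α).ι ≫ f) K⸨X⸩),
      (∀ j, R.chartCoord α x j ∈ scaledIntegers K m) →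
      x.incl _ ∈ Points.incl U '' RU.ball K C ∪ R.ballAround K (-m) ((U : Set X)ᶜ) := by
  let V := (R.chart α).toScheme
  let v : V ⟶ X := (R.chart α).ι
  have : IsClosedImmersion (R.emb α) := R.emb_closed α
  have : IsAffine V := (IsClosedImmersion.isAffine_surjective_of_isAffine (R.emb α)).1
  let π : MvPolynomial (Fin (R.dim α)) 𝔽 →+* Γ(V, ⊤) := AffSpace.polyFn (v ≫ f) (R.emb α)
  have hπ : Function.Surjective π :=
    AffSpace.eval₂Hom_coord_surjective (v ≫ f) (R.emb α) (R.emb_over α)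
  -- The common zeros of `H` form `V ∖ U`. The first alternative puts them on `V`; it is not covered
  -- by the second when `RU.I` is empty.
  let H : Set (MvPolynomial (Fin (R.dim α)) 𝔽) :=
    {p | π p = 0 ∨ ∃ β : RU.I, ∀ q ∈ V.basicOpen (π p), v q ∈ U.ι ''ᵁ RU.chart β}
  -- The generators are taken inside `H` itself, so that each nonzero one on `V` comes with a chart
  -- of `U`.
  obtain ⟨T, hTH, hT⟩ := (Submodule.fg_span_iff_fg_span_finset_subset H).mp
    (IsNoetherian.noetherian (Ideal.span H))
  -- The first `m` bounds the coordinates of `x`; the second is the closeness to `Z`, giving radius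
  -- `-m`.
  obtain ⟨N, hN⟩ := hasApproximation_of_finite T.finite_toSet m m
  have hball (p : T) : ∃ C : ℕ, ∀ (K : Type u) [Field K] [Algebra 𝔽 K]
      (x : Points (v ≫ f) K⸨X⸩),
      (∀ j, x.eval (AffSpace.coordFn (R.emb α) j) ∈ fil K (-m)) → x.eval (π p) ∉ fil K N →
      x.map v rfl ∈ Points.incl U '' RU.ball K C := by
    obtain h0 | ⟨β, hβ⟩ := hTH p.2
    · exact ⟨0, fun K _ _ x _ h ↦ (h (by rw [h0, map_zero]; exact zero_mem _)).elim⟩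
    · exact exists_map_mem_ball RU v (R.emb α) (R.emb_over α) (π p) β hβ m N
  obtain ⟨C, hC⟩ := Finite.exists_nat_forall hball fun p a b hab h K _ _ x hx hs ↦
    Set.image_mono (RU.ball_mono K (by exact_mod_cast hab)) (h K x hx hs)
  refine ⟨C, fun K _ _ x hx ↦ ?_⟩
  simp only [mem_scaledIntegers_iff, chartCoord_eq_eval] at hx
  by_cases hsmall : ∀ p ∈ T, x.eval (π p) ∈ fil K N
  swap
  · push Not at hsmall
    obtain ⟨p, hp, hpx⟩ := hsmall
    exact Or.inl (hC ⟨p, hp⟩ K x hx hpx)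
  right
  obtain ⟨z, hz, hxz⟩ := hN K (fun j ↦ x.eval (AffSpace.coordFn (R.emb α) j)) hx fun p hp ↦ by
    rw [← Points.eval_polyFn]
    exact hsmall p hp
  have hzH (p) (hp : p ∈ H) : MvPolynomial.aeval z p = 0 := by
    have h1 : Ideal.span H ≤ RingHom.ker (MvPolynomial.aeval (R := 𝔽) z) := by
      rw [Ideal.span, hT]
      exact Ideal.span_le.mpr hz
    exact h1 (Ideal.subset_span hp)
  -- Evaluation at `z` kills `ker π`, so it descends to the functions on `V` and defines a point
  -- `y`.
  let φ : Γ(V, ⊤) →+* K⸨X⸩ := π.liftOfSurjective hπ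
    ⟨(MvPolynomial.aeval (R := 𝔽) z).toRingHom, fun p hp ↦ hzH p (Or.inl hp)⟩
  have hφ (p) : φ (π p) = MvPolynomial.aeval z p :=
    RingHom.liftOfRightInverse_comp_apply π _ _ _ p
  obtain ⟨y, hy⟩ := Points.exists_eval_eq (f := v ≫ f) φ fun c ↦ by
    rw [← MvPolynomial.aeval_C z c, ← hφ]
    simp [π, AffSpace.polyFn]
  have hyU : y.incl (R.chart α) ∈ Points.In f K⸨X⸩ ((U : Set X)ᶜ) := by
    -- If `y` met `U`, it would meet a basic open `D(π p)` inside a chart of `U`. Then `p ∈ H`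
    -- vanishes at `z`, a contradiction.
    intro q hq
    have hq' : v (y.1 q) ∈ U := hq
    have hcov : (⟨v (y.1 q), hq'⟩ : U) ∈ ⨆ β, RU.chart β := RU.cover ▸ trivial
    obtain ⟨β, hβ⟩ := Opens.mem_iSup.mp hcov
    obtain ⟨h, hle, hyh⟩ := (isAffineOpen_top V).exists_basicOpen_le
      (V := v ⁻¹ᵁ U.ι ''ᵁ RU.chart β) ⟨y.1 q, ⟨_, hβ, rfl⟩⟩ trivial
    obtain ⟨p, rfl⟩ := hπ h
    refine (y.mem_basicOpen_iff (π p) q).mp hyh ?_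
    rw [hy, hφ]
    exact hzH p (Or.inr ⟨β, fun q hq ↦ hle hq⟩)
  refine Set.mem_biUnion hyU ⟨α, y, x, rfl, rfl, fun j ↦ ⟨_, ?_, (add_sub_cancel _ _).symm⟩⟩
  have hyj : y.eval (AffSpace.coordFn (R.emb α) j) = z j := by
    have := hφ (MvPolynomial.X j)
    rw [MvPolynomial.aeval_X] at this
    rw [← this, hy]
    simp [π, AffSpace.polyFn]
  rw [mem_scaledIntegers_iff, chartCoord_eq_eval, chartCoord_eq_eval, hyj, neg_neg]
  exact hxz j

end Rectification

end

theorem mainTheorem4 {𝔽 : Type u} [Field 𝔽] [Finite 𝔽] {X : Scheme.{u}}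
    (f : X ⟶ Spec (CommRingCat.of 𝔽)) [IsSmoothVariety f] (R : Rectification f)
    (U : X.Opens) (RU : Rectification (U.ι ≫ f)) (m : ℕ) :
    ∃ m' : ℕ, m < m' ∧ ∀ k : ℕ, 1 ≤ k →
      ∀ (K : Type u) [Field K] [Algebra 𝔽 K], Module.finrank 𝔽 K = k →
        R.ball K m ⊆
          Points.incl U '' RU.ball K m' ∪ R.ballAround K (-m) ((U : Set X)ᶜ) := by
  have := R.finite
  obtain ⟨C, hC⟩ := Finite.exists_nat_forall
    (fun α ↦ R.exists_mem_ball_or_mem_ballAround RU α m)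
    fun α a b hab h K _ _ x hx ↦ Set.union_subset_union_left _
      (Set.image_mono (RU.ball_mono K (by exact_mod_cast hab))) (h K x hx)
  -- Balls grow with the radius, so enlarging `C` is harmless; `m + 1` secures `m < m'`.
  refine ⟨max C (m + 1), by omega, fun k _ K _ _ _ ↦ ?_⟩
  rintro _ ⟨α, x, rfl, hx⟩
  exact Set.union_subset_union_left _ (Set.image_mono (RU.ball_mono K (by simp))) (hC α K x hx)
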